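/- Let $\mathbb{K}$ be a field, let $f\in\mathbb{K}[x]$ have degree $n$, let $a\in\mathbb{K}[x]$ have degree less than $n$, and let $m\le n$ and $d$ be positive integers. Let $M_a\in\mathbb{K}^{n\times n}$ be the matrix of multiplication by $a$ in $\mathbb{K}[x]/\langle f\rangle$ in the basis $(1,x,\dots,x^{n-1})$, and let $X=(I_m\ \ 0)^{T}\in\mathbb{K}^{n\times m}$. Define: * $H_{m,d}^{(a,f)}\in\mathbb{K}^{(md)\times(md)}$, the block Hankel matrix whose $(i,j)$ block, for $0\le i,j<d$, is $X^TM_a^{i+j}X\in\mathbb{K}^{m\times m}$; that is, the product of the matrix with block rows $X^T,X^TM_a,\dots,X^TM_a^{d-1}$ and the matrix with block columns $X,M_aX,\dots,M_a^{d-1}X$; * $\nu_m^{(a,f)}=\deg\sigma_1+\dots+\deg\sigma_m$, where $\sigma_1,\dots,\sigma_n\in\mathbb{K}[y]$ are the invariant factors of $yI_n-M_a$, ordered by decreasing degree; * $\nu_{m,m}^{(a,f)}$, the determinantal degree of the $\mathbb{K}[y]$-module $\mathcal{R}_{m,m}$ of all $r(x,y)\in\mathbb{K}[x,y]$ with $\deg_x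 r<m$ such that, for every $k\ge0$, the coefficients of $x^0,\dots,x^{m-1}$ in the remainder of $a(x)^k\,r(x,a(x))$ modulo $f$ all vanish; here $r=r_0(y)+\dots+r_{m-1}(y)x^{m-1}$ is identified with the vector $(r_0,\dots,r_{m-1})^T\in\mathbb{K}[y]^m$, and the determinantal degree is the degree of the determinant of a basis, which is also the least degree of the determinant of a nonsingular $m\times m$ matrix over $\mathbb{K}[y]$ with all columns in the module. A matrix $F\in\mathbb{K}(y)^{\ell\times m}$ is called describable in degree $d$ if $F=ND^{-1}=\hat D^{-1}\hat N$ for some polynomial matrices $N,\hat N\in\mathbb{K}[y]^{\ell\times m}$ and nonsingular $D\in\mathbb{K}[y]^{m\times m}$, $\hat D\in\mathbb{K}[y]^{\ell\times\ell}$ such that all entries of $D$ and $\hat D$ have degree at most $d$. Then $\operatorname{rank}H_{m,d}^{(a,f)}\le\nu_m^{(a,f)}$. If $\operatorname{rank}H_{m,d}^{(a,f)}=\nu_m^{(a,f)}$, then $\nu_{m,m}^{(a,f)}=\nu_m^{(a,f)}$ and $X^T(yI_n-M_a)^{-1}X$ is describable in degree $d$. In particular, if $\operatorname{rank}H_{m,d}^{(a,f)}=n$,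 then $\nu_{m,m}^{(a,f)}=\nu_m^{(a,f)}=n$ and $X^T(yI_n-M_a)^{-1}X$ is describable in degree $d$. -/

import Mathlib

open scoped Polynomial

namespace ModComp

noncomputable section

/-- The gcd `Δ_k` of the `k × k` minors of a polynomial matrix (a generator of the ideal spanned by
the minors, hence unique up to a nonzero constant), rows and columns being chosen without
repetition.  Since the order in which rows and columns are listed only affects the sign of a minor,
injective maps may be used in place of subsets. -/
def minorsGcd {K : Type*} [Field K] {n : ℕ} (A : Matrix (Fin n) (Fin n) K[X]) (k : ℕ) : K[X] :=
  Submodule.IsPrincipal.generator (Ideal.span (Set.range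
    fun p : (Fin k ↪ Fin n) × (Fin k ↪ Fin n) => (A.submatrix p.1 p.2).det))

/-- The invariant factors `σ_1, σ_2, …` (indexed here from `0`, so `invariantFactor A i` is
`σ_{i+1}`) of a nonsingular `n × n` polynomial matrix, up to nonzero constants, listed by decreasing
degree.  With `Δ_k` the gcd of the `k × k` minors (so that `Δ_0` is a unit), the Smith normal form
has diagonal entries `Δ_k / Δ_{k-1}` for `k = 1, …, n`, each dividing the next, so
`σ_{i+1} = Δ_{n-i} / Δ_{n-i-1}` for `i < n`. -/
def invariantFactor {K : Type*} [Field K] {n : ℕ} (A : Matrix (Fin n) (Fin n) K[X]) (i : ℕ) :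
    K[X] :=
  minorsGcd A (n - i) / minorsGcd A (n - i - 1)

/-- The matrix `M_a` of multiplication by `a` in `K[x]/⟨f⟩`, with respect to the basis
`1, x, …, x^(n-1)`, where `n` is the degree of `f`: column `j` holds the coefficients of
`a x^j rem f`. -/
def mulMatrix {K : Type*} [Field K] (n : ℕ) (f a : K[X]) : Matrix (Fin n) (Fin n) K :=
  Matrix.of fun i j => ((a * Polynomial.X ^ (j : ℕ)) % f).coeff (i : ℕ)

/-- `ν_m`: the sum of the degrees of the `m` invariant factors of largest degree of the
characteristic matrix `y I_n - M_a`. -/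
def nu {K : Type*} [Field K] (n m : ℕ) (f a : K[X]) : ℕ :=
  ∑ i ∈ Finset.range m, (invariantFactor (mulMatrix n f a).charmatrix i).natDegree

/-- For a vector `r = (r_0, …, r_{m-1})` over `K[y]`, standing for the bivariate polynomial
`r(x, y) = r_0(y) + r_1(y) x + ⋯ + r_{m-1}(y) x^(m-1)`, the univariate polynomial `r(x, a(x))`. -/
def evalAt {K : Type*} [Field K] {m : ℕ} (a : K[X]) (r : Fin m → K[X]) : K[X] :=
  ∑ j : Fin m, (r j).comp a * Polynomial.X ^ (j : ℕ)

theorem evalAt_add {K : Type*} [Field K] {m : ℕ} (a : K[X]) (r s : Fin m → K[X]) :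
    evalAt a (r + s) = evalAt a r + evalAt a s := by
  simp [evalAt, add_mul, Finset.sum_add_distrib]

theorem evalAt_smul {K : Type*} [Field K] {m : ℕ} (a p : K[X]) (r : Fin m → K[X]) :
    evalAt a (p • r) = p.comp a * evalAt a r := by
  simp [evalAt, Finset.mul_sum, mul_assoc]

/-- The truncated module of relations `R_{ℓ,m}`: the `K[y]`-module of the bivariate polynomials
`r(x, y)` of `x`-degree less than `m` (identified with their coefficient vectors in `K[y]^m`) such
that, for all `k ≥ 0`, the first `ℓ` coefficients of `a(x)^k r(x, a(x)) rem f` vanish. -/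
def relModule {K : Type*} [Field K] (l m : ℕ) (f a : K[X]) :
    Submodule K[X] (Fin m → K[X]) where
  carrier := {r | ∀ k i : ℕ, i < l → ((a ^ k * evalAt a r) % f).coeff i = 0}
  zero_mem' := by
    intro k i _
    simp [evalAt]
  add_mem' := by
    intro r s hr hs k i hi
    rw [evalAt_add, mul_add, Polynomial.add_mod, Polynomial.coeff_add, hr k i hi, hs k i hi,
      add_zero]
  smul_mem' := by
    intro p r hr k i hi
    rw [evalAt_smul]
    induction p using Polynomial.induction_on' with
    | add p q hp hq =>
      rw [Polynomial.add_comp, add_mul, mul_add, Polynomial.add_mod, Polynomial.coeff_add, hp, hq,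
        add_zero]
    | monomial e c =>
      have h : a ^ k * ((Polynomial.monomial e c).comp a * evalAt a r)
          = c • (a ^ (k + e) * evalAt a r) := by
        rw [Polynomial.monomial_comp, Polynomial.smul_eq_C_mul, pow_add]
        ring
      rw [h, Polynomial.mod_def, Polynomial.smul_modByMonic, ← Polynomial.mod_def,
        Polynomial.coeff_smul, hr (k + e) i hi, smul_zero]

/-- The determinantal degree of a `K[y]`-submodule of `K[y]^m` of rank `m`: the minimal degree of
the determinant of a nonsingular matrix whose columns belong to the submodule (the minimum is
attained exactly by the matrices whose columns form a basis). -/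
def detDegree {K : Type*} [Field K] {m : ℕ} (N : Submodule K[X] (Fin m → K[X])) : ℕ :=
  sInf {k : ℕ | ∃ R : Matrix (Fin m) (Fin m) K[X],
    R.det ≠ 0 ∧ (∀ j, (fun i => R i j) ∈ N) ∧ R.det.natDegree = k}

/-- `ν_{m,m}`: the determinantal degree of `R_{m,m}`. -/
def nuTrunc {K : Type*} [Field K] (m : ℕ) (f a : K[X]) : ℕ :=
  detDegree (relModule m m f a)

/-- The `n × m` matrix `X` whose transpose is `(I_m 0)`. -/
def projMatrix (K : Type*) [Field K] (n m : ℕ) : Matrix (Fin n) (Fin m) K :=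
  Matrix.of fun i j => if (i : ℕ) = (j : ℕ) then 1 else 0

/-- The `(md) × n` matrix with block rows `Xᵀ, Xᵀ M_a, …, Xᵀ M_a^(d-1)`. -/
def leftMatrix {K : Type*} [Field K] (n m d : ℕ) (f a : K[X]) :
    Matrix (Fin d × Fin m) (Fin n) K :=
  Matrix.of fun p j => ((projMatrix K n m).transpose * mulMatrix n f a ^ (p.1 : ℕ)) p.2 j

/-- The `n × (md)` matrix with block columns `X, M_a X, …, M_a^(d-1) X`. -/
def rightMatrix {K : Type*} [Field K] (n m d : ℕ) (f a : K[X]) :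
    Matrix (Fin n) (Fin d × Fin m) K :=
  Matrix.of fun i p => (mulMatrix n f a ^ (p.1 : ℕ) * projMatrix K n m) i p.2

/-- The `(md) × (md)` block Hankel matrix, whose block in position `(i, j)`, `0 ≤ i, j < d`, is
`Xᵀ M_a^(i+j) X`. -/
def blockHankel {K : Type*} [Field K] (n m d : ℕ) (f a : K[X]) :
    Matrix (Fin d × Fin m) (Fin d × Fin m) K :=
  leftMatrix n m d f a * rightMatrix n m d f a

/-- The matrix of rational functions `H(y) = Xᵀ (y I_n - M_a)⁻¹ X`. -/
def fractionH {K : Type*} [Field K] (n m : ℕ) (f a : K[X]) :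
    Matrix (Fin m) (Fin m) (RatFunc K) :=
  ((projMatrix K n m).map (algebraMap K (RatFunc K))).transpose *
    ((mulMatrix n f a).charmatrix.map (algebraMap K[X] (RatFunc K)))⁻¹ *
    (projMatrix K n m).map (algebraMap K (RatFunc K))

/-- A rational matrix is describable in degree `d` if it admits both a right fraction description
`N D⁻¹` and a left fraction description `D'⁻¹ N'` whose (nonsingular polynomial) denominators have
all their entries of degree at most `d`. -/
def IsDescribable {K : Type*} [Field K] {l m : ℕ} (F : Matrix (Fin l) (Fin m) (RatFunc K))
    (d : ℕ) : Prop :=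
  (∃ (N : Matrix (Fin l) (Fin m) K[X]) (D : Matrix (Fin m) (Fin m) K[X]),
    D.det ≠ 0 ∧ (∀ i j, (D i j).natDegree ≤ d) ∧
      F = N.map (algebraMap K[X] (RatFunc K)) * (D.map (algebraMap K[X] (RatFunc K)))⁻¹) ∧
  (∃ (N : Matrix (Fin l) (Fin m) K[X]) (D : Matrix (Fin l) (Fin l) K[X]),
    D.det ≠ 0 ∧ (∀ i j, (D i j).natDegree ≤ d) ∧
      F = (D.map (algebraMap K[X] (RatFunc K)))⁻¹ * N.map (algebraMap K[X] (RatFunc K)))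

end

end ModComp

/-! Write `M` for the multiplication matrix and let `K[y]` act on `K^n` through `M`. Let `W` be the
submodule generated by the columns of `X`. Everything is compared with `dim W`.

The block Hankel matrix is `L R`, where the columns of `R` lie in `W`, so its rank is at most `dim
W`. In turn `dim W ≤ ν_m` (`finrank_add_natDegree_minorsGcd_le`). Indeed `n - dim W` is the degree
of `det D`, where the columns of `D` form a basis of the relations modulo `W` between the last `n -
m` unit vectors. These relations are combinations of the columns of the last `n - m` rows of `yI -
M`, so the gcd `Δ_{n-m}` of minors divides `det D`, and `deg Δ_{n-m} = n - ν_m` by telescoping.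

If the rank equals `ν_m`, both inequalities are equalities: `R` spans `W` and `L` is injective on
`W`. Injectivity makes the truncated relations the same as the exact relations between the columns
of `X`, whose determinantal degree is `dim W`. Since `R` spans `W`, `M^d X` is a combination of the
lower blocks, which gives a monic right denominator of degree `d`. Since `L` is injective on `W`,
`Xᵀ M^d` agrees on `W` with a combination of the rows of `L`, which gives a left denominator. -/

open scoped Matrix

namespace ModComp

variable {K : Type*} [Field K]

/-! ### Ideals of minors and degrees of invariant factors -/

/-- The ideal generated by the `k × k` minors of a square polynomial matrix. -/
noncomputable def minorsIdeal {n : ℕ} (A : Matrix (Fin n) (Fin n) K[X]) (k : ℕ) : Ideal K[X] :=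
  Ideal.span (Set.range
    fun p : (Fin k ↪ Fin n) × (Fin k ↪ Fin n) => (A.submatrix p.1 p.2).det)

theorem minorsGcd_dvd_iff {n k : ℕ} {A : Matrix (Fin n) (Fin n) K[X]} {p : K[X]} :
    minorsGcd A k ∣ p ↔ p ∈ minorsIdeal A k :=
  (Submodule.IsPrincipal.mem_iff_generator_dvd (minorsIdeal A k)).symm

theorem minorsGcd_mem {n k : ℕ} (A : Matrix (Fin n) (Fin n) K[X]) :
    minorsGcd A k ∈ minorsIdeal A k :=
  minorsGcd_dvd_iff.mp dvd_rfl

theorem det_submatrix_mem_minorsIdeal {n k : ℕ} (A : Matrix (Fin n) (Fin n) K[X])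
    (p q : Fin k ↪ Fin n) : (A.submatrix p q).det ∈ minorsIdeal A k :=
  Ideal.subset_span ⟨(p, q), rfl⟩

theorem minorsIdeal_succ_le {n k : ℕ} (A : Matrix (Fin n) (Fin n) K[X]) :
    minorsIdeal A (k + 1) ≤ minorsIdeal A k := by
  refine Ideal.span_le.mpr ?_
  rintro _ ⟨⟨p, q⟩, rfl⟩
  simp only [Matrix.det_succ_row_zero, SetLike.mem_coe]
  refine Ideal.sum_mem _ fun j _ => Ideal.mul_mem_left _ _ ?_
  exact det_submatrix_mem_minorsIdeal A ((Fin.succEmb k).trans p) ((Fin.succAboveEmb j).trans q)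

theorem minorsGcd_dvd_succ {n k : ℕ} (A : Matrix (Fin n) (Fin n) K[X]) :
    minorsGcd A k ∣ minorsGcd A (k + 1) :=
  minorsGcd_dvd_iff.mpr (minorsIdeal_succ_le A (minorsGcd_mem A))

theorem minorsGcd_self_associated {n : ℕ} (A : Matrix (Fin n) (Fin n) K[X]) :
    Associated (minorsGcd A n) A.det := by
  refine associated_of_dvd_dvd (minorsGcd_dvd_iff.mpr ?_) ?_
  · exact det_submatrix_mem_minorsIdeal A (Function.Embedding.refl _) (Function.Embedding.refl _)
  · have h : minorsIdeal A n ≤ Ideal.span {A.det} := by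
      refine Ideal.span_le.mpr ?_
      rintro _ ⟨⟨p, q⟩, rfl⟩
      -- Selecting rows and columns is multiplication by selections from the identity, so `det A`
      -- divides every such minor.
      have : A.submatrix p q = (1 : Matrix (Fin n) (Fin n) K[X]).submatrix p id * A *
          (1 : Matrix (Fin n) (Fin n) K[X]).submatrix id q := by
        ext i j
        simp [Matrix.mul_apply, Matrix.one_apply]
      simp only [this, Matrix.det_mul, SetLike.mem_coe, Ideal.mem_span_singleton]
      exact Dvd.dvd.mul_right (dvd_mul_left _ _) _
    exact Ideal.mem_span_singleton.mp (h (minorsGcd_mem A))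

theorem minorsGcd_ne_zero {n k : ℕ} {A : Matrix (Fin n) (Fin n) K[X]} (hA : A.det ≠ 0)
    (hk : k ≤ n) : minorsGcd A k ≠ 0 := by
  induction hk using Nat.decreasingInduction with
  | self => exact (minorsGcd_self_associated A).ne_zero_iff.mpr hA
  | of_succ k _ ih => exact ne_zero_of_dvd_ne_zero ih (minorsGcd_dvd_succ A)

/-- The product of the quotients `Δ_{n-i} / Δ_{n-i-1}` telescopes to `Δ_n / Δ_{n-m}`, and `Δ_n` is
associated to `det A`. -/
theorem sum_natDegree_invariantFactor {n m : ℕ} {A : Matrix (Fin n) (Fin n) K[X]}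
    (hA : A.det ≠ 0) (hm : m ≤ n) :
    ∑ i ∈ Finset.range m, (invariantFactor A i).natDegree + (minorsGcd A (n - m)).natDegree
      = A.det.natDegree := by
  induction m with
  | zero =>
    simpa using Polynomial.natDegree_eq_of_degree_eq
      (Polynomial.degree_eq_degree_of_associated (minorsGcd_self_associated A))
  | succ m ih =>
    rw [← ih (by omega), Finset.sum_range_succ, add_assoc]
    congr 1
    obtain ⟨k, hk⟩ : ∃ k, n = k + 1 + m := ⟨n - (m + 1), by omega⟩
    have h1 : n - m = k + 1 := by omega
    have h2 : n - (m + 1) = k := by omega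
    have h3 : n - m - 1 = k := by omega
    rw [invariantFactor, h3, h1, h2]
    obtain ⟨c, hc⟩ := minorsGcd_dvd_succ (k := k) A
    have h0 := minorsGcd_ne_zero hA (show k + 1 ≤ n by omega)
    rw [hc] at h0 ⊢
    rw [mul_div_cancel_left₀ _ (left_ne_zero_of_mul h0),
      Polynomial.natDegree_mul (left_ne_zero_of_mul h0) (right_ne_zero_of_mul h0), add_comm]

/-- The determinant of a product `B * Q`, where `B` consists of `k` rows of `A`, lies in the ideal
generated by the `k × k` minors of `A`. -/
theorem det_submatrix_mul_mem_minorsIdeal {n k : ℕ} (A : Matrix (Fin n) (Fin n) K[X])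
    (p : Fin k ↪ Fin n) (Q : Matrix (Fin n) (Fin k) K[X]) :
    (A.submatrix p id * Q).det ∈ minorsIdeal A k := by
  have h : (A.submatrix p id * Q)ᵀ = fun j => ∑ i, Q i j • fun l => A (p l) i := by
    ext j l
    simp [Matrix.mul_apply, Finset.sum_apply, mul_comm]
  rw [← Matrix.det_transpose, h]
  -- As in the Cauchy–Binet formula: multilinear expansion over choices `q` of columns of `A`; a
  -- non-injective choice repeats a column and contributes zero.
  change Matrix.detRowAlternating.toMultilinearMap (fun j => ∑ i, Q i j • fun l => A (p l) i) ∈ _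
  rw [MultilinearMap.map_sum]
  refine Ideal.sum_mem _ fun q _ => ?_
  rw [MultilinearMap.map_smul_univ]
  refine Ideal.mul_mem_left _ _ ?_
  by_cases hq : Function.Injective q
  · have := det_submatrix_mem_minorsIdeal A p ⟨q, hq⟩
    rwa [← Matrix.det_transpose] at this
  · obtain ⟨i, j, hij, hne⟩ : ∃ i j, q i = q j ∧ i ≠ j := by
      simpa [Function.Injective] using hq
    have : Matrix.detRowAlternating (fun (i : Fin k) (l : Fin k) => A (p l) (q i)) = 0 :=
      Matrix.det_zero_of_row_eq hne (by ext l; simp [hij])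
    exact this ▸ Ideal.zero_mem _

/-! ### Determinantal degree as the dimension of a quotient -/

open Polynomial Module Submodule in
/-- A full-rank submodule `N` of `K[y]^m` is spanned by the columns of a nonsingular matrix, and
the degree of the determinant of that matrix is the dimension of the quotient. -/
theorem exists_basis_matrix {m : ℕ} {N : Submodule K[X] (Fin m → K[X])}
    (h : finrank K[X] N = finrank K[X] (Fin m → K[X])) :
    ∃ R : Matrix (Fin m) (Fin m) K[X], R.det ≠ 0 ∧ (∀ j, (fun i => R i j) ∈ N) ∧
      R.det.natDegree = finrank K ((Fin m → K[X]) ⧸ N) ∧ ∀ v ∈ N, ∃ c, R.mulVec c = v := by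
  let b := Pi.basisFun K[X] (Fin m)
  let s := smithNormalFormCoeffs b h
  let t := smithNormalFormTopBasis b h
  let u := smithNormalFormBotBasis b h
  have hu : ∀ i, (u i : Fin m → K[X]) = s i • t i := smithNormalFormBotBasis_def b h
  have hs : ∀ i, s i ≠ 0 := smithNormalFormCoeffs_ne_zero b h
  -- In Smith form the basis matrix is an invertible matrix times `diagonal s`, and the quotient is
  -- the direct sum of the `K[y]/(s_i)`.
  have hR : (Matrix.of fun i j => (u j : Fin m → K[X]) i)
      = b.toMatrix t * Matrix.diagonal s := by
    ext i j
    simp [hu, Basis.toMatrix_apply, b, mul_comm]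
  have hunit : IsUnit (b.toMatrix t).det := by
    rw [← Basis.det_apply]
    exact b.isUnit_det t
  have hdet : (Matrix.of fun i j => (u j : Fin m → K[X]) i).det
      = (b.toMatrix t).det * ∏ i, s i := by
    rw [hR, Matrix.det_mul, Matrix.det_diagonal]
  refine ⟨Matrix.of fun i j => (u j : Fin m → K[X]) i, ?_, fun j => (u j).2, ?_, fun v hv => ?_⟩
  · rw [hdet]
    exact mul_ne_zero hunit.ne_zero (Finset.prod_ne_zero_iff.mpr fun i _ => hs i)
  · have : ∀ i, Module.Finite K (K[X] ⧸ Ideal.span ({s i} : Set K[X])) := fun i =>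
      PowerBasis.finite (AdjoinRoot.powerBasis (hs i))
    rw [hdet, natDegree_mul hunit.ne_zero (Finset.prod_ne_zero_iff.mpr fun i _ => hs i),
      natDegree_eq_zero_of_isUnit hunit, zero_add, natDegree_prod _ _ fun i _ => hs i,
      finrank_quotient_eq_sum K b h]
    exact Finset.sum_congr rfl fun i _ => finrank_quotient_span_eq_natDegree.symm
  · refine ⟨u.repr ⟨v, hv⟩, ?_⟩
    have := congrArg Subtype.val (u.sum_repr ⟨v, hv⟩)
    refine Eq.trans ?_ this
    funext i
    simp [-Basis.sum_repr, Matrix.mulVec, dotProduct, mul_comm]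

open Module in
-- Any competing matrix factors through the basis matrix, whose determinant therefore divides the
-- other one.
theorem detDegree_eq_finrank {m : ℕ} {N : Submodule K[X] (Fin m → K[X])}
    (h : finrank K[X] N = finrank K[X] (Fin m → K[X])) :
    detDegree N = finrank K ((Fin m → K[X]) ⧸ N) := by
  obtain ⟨R, h0, hR, hdeg, hspan⟩ := exists_basis_matrix h
  refine le_antisymm (Nat.sInf_le ⟨R, h0, hR, hdeg⟩) (le_csInf ⟨_, R, h0, hR, rfl⟩ ?_)
  rintro _ ⟨S, hS0, hS, rfl⟩
  choose c hc using fun j => hspan _ (hS j)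
  have : S = R * Matrix.of fun i j => c j i := by
    refine Matrix.ext fun i j => ?_
    exact (congrFun (hc j) i).symm
  rw [this, Matrix.det_mul] at hS0
  rw [← hdeg, this, Matrix.det_mul]
  exact Polynomial.natDegree_le_of_dvd (dvd_mul_right _ _) hS0

open Module in
theorem finrank_eq_of_smul_mem {m : ℕ} {N : Submodule K[X] (Fin m → K[X])} {p : K[X]} (hp : p ≠ 0)
    (h : ∀ v, p • v ∈ N) : finrank K[X] N = finrank K[X] (Fin m → K[X]) :=
  le_antisymm (Submodule.finrank_le N)
    (((LinearMap.lsmul K[X] (Fin m → K[X]) p).codRestrict N h).finrank_le_finrank_of_injective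
      ((LinearMap.lsmul_injective hp).codRestrict _))

open Module in
theorem finrank_quotient_eq_finrank_range {m : ℕ} {N : Submodule K[X] (Fin m → K[X])}
    {U : Type*} [AddCommGroup U] [Module K U] (φ : (Fin m → K[X]) →ₗ[K] U)
    (h : ∀ r, r ∈ N ↔ φ r = 0) :
    finrank K ((Fin m → K[X]) ⧸ N) = finrank K (LinearMap.range φ) := by
  have hN : N.restrictScalars K = LinearMap.ker φ := by
    ext r
    simp [h]
  rw [← (Submodule.Quotient.restrictScalarsEquiv K N).finrank_eq,
    (Submodule.quotEquivOfEq _ _ hN).finrank_eq, φ.quotKerEquivRange.finrank_eq]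

/-! ### The `K[y]`-module structure on `K^n` and division by `yI - M` -/

/-- The `K`-linear map `K[y]^n → K^n` describing the `K[y]`-module structure of `K^n` given by `M`:
`v` is sent to the sum of the `v_j(M) e_j`. -/
noncomputable def moduleEval {n : ℕ} (M : Matrix (Fin n) (Fin n) K) :
    (Fin n → K[X]) →ₗ[K] (Fin n → K) where
  toFun v := ∑ j, Polynomial.aeval M (v j) *ᵥ Pi.single j 1
  map_add' v w := by simp only [Pi.add_apply, map_add, Matrix.add_mulVec, Finset.sum_add_distrib]
  map_smul' c v := by
    simp only [Pi.smul_apply, map_smul, Matrix.smul_mulVec, Finset.smul_sum, RingHom.id_apply]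

section
variable {n m : ℕ} (M : Matrix (Fin n) (Fin n) K)

theorem moduleEval_apply (v : Fin n → K[X]) :
    moduleEval M v = ∑ j, Polynomial.aeval M (v j) *ᵥ Pi.single j 1 := rfl

theorem moduleEval_smul (p : K[X]) (v : Fin n → K[X]) :
    moduleEval M (p • v) = Polynomial.aeval M p *ᵥ moduleEval M v := by
  simp only [moduleEval_apply, Pi.smul_apply, smul_eq_mul, map_mul, ← Matrix.mulVec_mulVec,
    Matrix.mulVec_sum]

theorem moduleEval_C (u : Fin n → K) : moduleEval M (fun i => Polynomial.C (u i)) = u := by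
  rw [moduleEval_apply]
  ext i
  simp [Matrix.algebraMap_eq_diagonal, Finset.sum_apply, Pi.single_apply]

theorem X_smul_map_C (A : Matrix (Fin n) (Fin m) K) :
    (Polynomial.X : K[X]) • A.map Polynomial.C
      = M.charmatrix * A.map Polynomial.C + (M * A).map Polynomial.C := by
  rw [Matrix.charmatrix, RingHom.mapMatrix_apply, Matrix.sub_mul,
    Matrix.map_mul, sub_add_cancel]
  exact Matrix.smul_eq_diagonal_mul _ _

theorem exists_pow_smul_map_C_eq (A : Matrix (Fin n) (Fin m) K) (k : ℕ) :
    ∃ Q : Matrix (Fin n) (Fin m) K[X], (Polynomial.X ^ k : K[X]) • A.map Polynomial.C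
      = M.charmatrix * Q + (M ^ k * A).map Polynomial.C := by
  induction k with
  | zero => 
    exact ⟨0, by rw [pow_zero, pow_zero, one_smul, Matrix.mul_zero, Matrix.one_mul, zero_add]⟩
  | succ k ih =>
    obtain ⟨Q, hQ⟩ := ih
    refine ⟨(Polynomial.X : K[X]) • Q + (M ^ k * A).map Polynomial.C, ?_⟩
    rw [pow_succ', mul_smul, hQ, smul_add, X_smul_map_C M, Matrix.mul_add, Matrix.mul_smul,
      pow_succ', Matrix.mul_assoc, add_assoc]

theorem moduleEval_charmatrix_mulVec (q : Fin n → K[X]) :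
    moduleEval M (M.charmatrix *ᵥ q) = 0 := by
  have h : M.charmatrix *ᵥ q = ∑ j, q j • fun i => M.charmatrix i j := by
    ext1 i
    simp [Matrix.mulVec, dotProduct, Finset.sum_apply, mul_comm]
  rw [h, map_sum]
  refine Finset.sum_eq_zero fun j _ => ?_
  have hj : (fun i => M.charmatrix i j)
      = (Polynomial.X : K[X]) • (fun i => Polynomial.C ((Pi.single j 1 : Fin n → K) i))
        - fun i => Polynomial.C ((M *ᵥ Pi.single j 1) i) := by
    ext1 i
    by_cases hij : i = j
    · subst hij; simp
    · simp [hij]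
  rw [moduleEval_smul, hj, map_sub, moduleEval_smul, moduleEval_C, moduleEval_C]
  simp

/-- Left division by `yI - M`, with constant remainder. Together with `moduleEval_charmatrix_mulVec`
it shows that the kernel of `moduleEval M` is the image of `yI - M`. -/
theorem exists_eq_charmatrix_mulVec_add (v : Fin n → K[X]) :
    ∃ q, v = M.charmatrix *ᵥ q + fun i => Polynomial.C (moduleEval M v i) := by
  suffices h : ∃ (q : Fin n → K[X]) (u : Fin n → K), v = M.charmatrix *ᵥ q +
      fun i => Polynomial.C (u i) by
    obtain ⟨q, u, h⟩ := h
    refine ⟨q, ?_⟩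
    have hu : moduleEval M v = u := by
      rw [h, map_add, moduleEval_charmatrix_mulVec, moduleEval_C, zero_add]
    rwa [hu]
  induction v using Pi.single_induction with
  | zero => exact ⟨0, 0, by ext1; simp⟩
  | add v w hv hw =>
    obtain ⟨q, u, hq⟩ := hv
    obtain ⟨q', u', hq'⟩ := hw
    refine ⟨q + q', u + u', ?_⟩
    rw [Matrix.mulVec_add, hq, hq']
    ext1 i
    simp only [Pi.add_apply, map_add]
    ring
  | single j p =>
    induction p using Polynomial.induction_on' with
    | add p p' hp hp' =>
      obtain ⟨q, u, hq⟩ := hp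
      obtain ⟨q', u', hq'⟩ := hp'
      refine ⟨q + q', u + u', ?_⟩
      rw [Matrix.mulVec_add, Pi.single_add, hq, hq']
      ext1 i
      simp only [Pi.add_apply, map_add]
      ring
    | monomial k c =>
      obtain ⟨Q, hQ⟩ := exists_pow_smul_map_C_eq M (c • (1 : Matrix (Fin n) (Fin n) K)) k
      refine ⟨fun i => Q i j, fun i => (M ^ k * (c • (1 : Matrix (Fin n) (Fin n) K))) i j, ?_⟩
      ext1 i
      have := congrFun (congrFun hQ i) j
      simp only [Matrix.add_apply, Matrix.smul_apply, Matrix.map_apply, Matrix.mul_apply] at this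
      simp only [Pi.add_apply, Matrix.mulVec, dotProduct, Matrix.mul_apply, Matrix.smul_apply]
      rw [← this]
      by_cases hij : i = j
      · subst hij; simp [Polynomial.X_pow_mul, Polynomial.C_mul_X_pow_eq_monomial]
      · simp [hij]

end

/-! ### Transfer matrices and fraction descriptions -/

/-- In a nonzero kernel vector, take an entry of largest degree: `X ^ d` times its leading term
cannot be cancelled by the products with entries of `B`. -/
theorem det_X_pow_smul_one_sub_ne_zero {m d : ℕ} (B : Matrix (Fin m) (Fin m) K[X])
    (hB : ∀ i j, (B i j).natDegree < d) :
    ((Polynomial.X ^ d : K[X]) • (1 : Matrix (Fin m) (Fin m) K[X]) - B).det ≠ 0 := by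
  intro h
  obtain ⟨v, hv0, hv⟩ := Matrix.exists_mulVec_eq_zero_iff.mpr h
  obtain ⟨j₀, hj₀⟩ : ∃ j, v j ≠ 0 := by
    by_contra! hc
    exact hv0 (funext hc)
  have : Nonempty (Fin m) := ⟨j₀⟩
  obtain ⟨i, hi⟩ := Finite.exists_max fun i => (v i).degree
  have hi0 : v i ≠ 0 := by
    intro h0
    have := hi j₀
    rw [h0, Polynomial.degree_zero, le_bot_iff, Polynomial.degree_eq_bot] at this
    exact hj₀ this
  rw [Matrix.sub_mulVec, Matrix.smul_mulVec, Matrix.one_mulVec, sub_eq_zero] at hv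
  have hrow : Polynomial.X ^ d * v i = ∑ j, B i j * v j := congrFun hv i
  have hc := congrArg (fun p => p.coeff ((v i).natDegree + d)) hrow
  simp only [Polynomial.coeff_X_pow_mul, Polynomial.finsetSum_coeff] at hc
  rw [Finset.sum_eq_zero] at hc
  · exact hi0 (Polynomial.leadingCoeff_eq_zero.mp hc)
  · intro j _
    refine Polynomial.coeff_eq_zero_of_natDegree_lt (lt_of_le_of_lt Polynomial.natDegree_mul_le ?_)
    have := Polynomial.natDegree_le_natDegree (hi j)
    have := hB i j
    omega

/-- The block Krylov matrix with block columns `Y, M Y, …, M^(d-1) Y`. -/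
noncomputable def krylov {n m : ℕ} (M : Matrix (Fin n) (Fin n) K) (Y : Matrix (Fin n) (Fin m) K)
    (d : ℕ) : Matrix (Fin n) (Fin d × Fin m) K :=
  Matrix.of fun i p => (M ^ (p.1 : ℕ) * Y) i p.2

theorem krylov_mul {n m d k : ℕ} (M : Matrix (Fin n) (Fin n) K) (Y : Matrix (Fin n) (Fin m) K)
    (G : Matrix (Fin d × Fin m) (Fin k) K) :
    krylov M Y d * G = ∑ i : Fin d, M ^ (i : ℕ) * Y * Matrix.of fun a b => G (i, a) b := by
  ext a b
  simp [Matrix.mul_apply, krylov, Fintype.sum_prod_type, Matrix.sum_apply]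

/-- The matrix of rational functions `P (y I - M)⁻¹ Y`. -/
noncomputable def transferMatrix {l n m : ℕ} (P : Matrix (Fin l) (Fin n) K)
    (M : Matrix (Fin n) (Fin n) K) (Y : Matrix (Fin n) (Fin m) K) :
    Matrix (Fin l) (Fin m) (RatFunc K) :=
  P.map (algebraMap K (RatFunc K)) * (M.charmatrix.map (algebraMap K[X] (RatFunc K)))⁻¹ *
    Y.map (algebraMap K (RatFunc K))

theorem isUnit_det_map {ι : Type*} [Fintype ι] [DecidableEq ι] {D : Matrix ι ι K[X]}
    (hD : D.det ≠ 0) :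
    IsUnit (D.map (algebraMap K[X] (RatFunc K))).det := by
  rw [← RingHom.mapMatrix_apply, ← RingHom.map_det, isUnit_iff_ne_zero]
  exact (map_ne_zero_iff _ (IsFractionRing.injective K[X] (RatFunc K))).mpr hD

theorem isUnit_det_charmatrix_map {ι : Type*} [Fintype ι] [DecidableEq ι] (M : Matrix ι ι K) :
    IsUnit (M.charmatrix.map (algebraMap K[X] (RatFunc K))).det :=
  isUnit_det_map M.charpoly_monic.ne_zero

theorem map_C_map {ι κ : Type*} (A : Matrix ι κ K) :
    (A.map Polynomial.C).map (algebraMap K[X] (RatFunc K)) = A.map (algebraMap K (RatFunc K)) := by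
  ext i j
  exact (IsScalarTower.algebraMap_apply K K[X] (RatFunc K) (A i j)).symm

theorem transferMatrix_transpose {l n m : ℕ} (P : Matrix (Fin l) (Fin n) K)
    (M : Matrix (Fin n) (Fin n) K) (Y : Matrix (Fin n) (Fin m) K) :
    (transferMatrix P M Y)ᵀ = transferMatrix Yᵀ Mᵀ Pᵀ := by
  rw [transferMatrix, transferMatrix, Matrix.charmatrix_transpose, Matrix.transpose_mul,
    Matrix.transpose_mul, Matrix.transpose_nonsing_inv, Matrix.mul_assoc]
  rfl

/-- If `E` vanishes on an `M`-stable space, the column space of `R`, that contains the columns of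
`Y`, then `E (y I - M)⁻¹ Y = 0`. -/
theorem transferMatrix_eq_zero {l n m : ℕ} {ι : Type*} [Fintype ι] [DecidableEq ι]
    {E : Matrix (Fin l) (Fin n) K}
    {M : Matrix (Fin n) (Fin n) K} {Y : Matrix (Fin n) (Fin m) K} {R : Matrix (Fin n) ι K}
    {A : Matrix ι ι K} {Z : Matrix ι (Fin m) K} (hE : E * R = 0) (hM : M * R = R * A)
    (hY : Y = R * Z) : transferMatrix E M Y = 0 := by
  let toRat := algebraMap K[X] (RatFunc K)
  -- The relation `M R = R A` passes to characteristic matrices, hence to inverses: `(yI - M)⁻¹ R =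
  -- R (yI - A)⁻¹`, which `E` kills on the left.
  have hchar : M.charmatrix * R.map Polynomial.C = R.map Polynomial.C * A.charmatrix := by
    rw [Matrix.charmatrix, Matrix.charmatrix, RingHom.mapMatrix_apply, RingHom.mapMatrix_apply,
      Matrix.sub_mul, Matrix.mul_sub, ← Matrix.map_mul, ← Matrix.map_mul, hM]
    congr 1
    ext1 i j
    simp only [Matrix.scalar_apply, Matrix.diagonal_mul, Matrix.mul_diagonal, mul_comm]
  have hrat : M.charmatrix.map toRat * R.map (algebraMap K (RatFunc K))
      = R.map (algebraMap K (RatFunc K)) * A.charmatrix.map toRat := by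
    rw [← map_C_map, ← Matrix.map_mul, hchar, Matrix.map_mul]
  have hinv : (M.charmatrix.map toRat)⁻¹ * R.map (algebraMap K (RatFunc K))
      = R.map (algebraMap K (RatFunc K)) * (A.charmatrix.map toRat)⁻¹ := by
    rw [← Matrix.mul_nonsing_inv_cancel_right (A.charmatrix.map toRat)
      ((M.charmatrix.map toRat)⁻¹ * R.map (algebraMap K (RatFunc K)))
      (isUnit_det_charmatrix_map A), Matrix.mul_assoc _ (R.map _), ← hrat,
      Matrix.nonsing_inv_mul_cancel_left _ _ (isUnit_det_charmatrix_map M)]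
  rw [transferMatrix, hY, Matrix.map_mul, ← Matrix.mul_assoc, Matrix.mul_assoc (E.map _), hinv,
    ← Matrix.mul_assoc, ← Matrix.map_mul, hE]
  simp

/-- The denominator is `D = y^d I - ∑ y^i F_i`, with `F_i` the blocks of `G`. Dividing `Y D` by `yI
- M` leaves the remainder `M^d Y - krylov M Y d * G`, whose contribution vanishes by `h`; the
quotient `S` gives the numerator `P S`. -/
theorem exists_right_description {l n m d : ℕ} (P : Matrix (Fin l) (Fin n) K)
    (M : Matrix (Fin n) (Fin n) K) (Y : Matrix (Fin n) (Fin m) K)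
    (G : Matrix (Fin d × Fin m) (Fin m) K) (hd : 0 < d)
    (h : transferMatrix P M (M ^ d * Y - krylov M Y d * G) = 0) :
    ∃ (N : Matrix (Fin l) (Fin m) K[X]) (D : Matrix (Fin m) (Fin m) K[X]),
    D.det ≠ 0 ∧ (∀ i j, (D i j).natDegree ≤ d) ∧
      transferMatrix P M Y = N.map (algebraMap K[X] (RatFunc K)) *
        (D.map (algebraMap K[X] (RatFunc K)))⁻¹ := by
  choose Q hQ using fun k => exists_pow_smul_map_C_eq M Y k
  let F (i : Fin d) : Matrix (Fin m) (Fin m) K := Matrix.of fun a b => G (i, a) b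
  let S : Matrix (Fin n) (Fin m) K[X] := Q d - ∑ i : Fin d, Q i * (F i).map Polynomial.C
  let B : Matrix (Fin m) (Fin m) K[X] :=
    ∑ i : Fin d, (Polynomial.X ^ (i : ℕ) : K[X]) •
      (F i).map Polynomial.C
  let D : Matrix (Fin m) (Fin m) K[X] := (Polynomial.X ^ d : K[X]) • 1 - B
  have hB : ∀ i j, (B i j).natDegree < d := by
    intro i j
    refine lt_of_le_of_lt ?_ (Nat.sub_one_lt_of_lt hd)
    simp only [B, Matrix.sum_apply]
    refine Polynomial.natDegree_sum_le_of_forall_le _ _ fun k _ => ?_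
    simp only [Matrix.smul_apply, Matrix.map_apply, smul_eq_mul, mul_comm (Polynomial.X ^ _)]
    exact (Polynomial.natDegree_C_mul_X_pow_le _ _).trans (by omega)
  have hD0 : D.det ≠ 0 := det_X_pow_smul_one_sub_ne_zero B hB
  have hdiv : Y.map Polynomial.C * D = M.charmatrix *
      S +
      (M ^ d * Y - krylov M Y d * G).map Polynomial.C := by
    have hsum : Y.map Polynomial.C * B = ∑ i : Fin d,
        (M.charmatrix * (Q i * (F i).map Polynomial.C) +
        (M ^ (i : ℕ) * Y * F i).map Polynomial.C) := by
      rw [Matrix.mul_sum]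
      refine Finset.sum_congr rfl fun i _ => ?_
      rw [Matrix.mul_smul, ← Matrix.smul_mul, hQ, Matrix.add_mul,
        Matrix.map_mul (f := Polynomial.C) (L := M ^ (i : ℕ) * Y), Matrix.mul_assoc]
    have hmap : (krylov M Y d * G).map Polynomial.C = ∑ i : Fin d,
        (M ^ (i : ℕ) * Y * F i).map Polynomial.C := by
      rw [krylov_mul]
      exact map_sum (Polynomial.C : K →+* K[X]).toAddMonoidHom.mapMatrix _ _
    rw [Matrix.mul_sub, hsum, Matrix.mul_smul, Matrix.mul_one, hQ d,
      show M.charmatrix * S = _ from Matrix.mul_sub _ _ _,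
      Matrix.map_sub _ (fun a b => Polynomial.C_sub), hmap, Finset.sum_add_distrib, Matrix.mul_sum]
    abel
  refine ⟨P.map Polynomial.C *
    S, D, hD0, ?_, ?_⟩
  · intro i j
    refine (Polynomial.natDegree_sub_le_of_le ?_ (hB i j).le).trans (max_self d).le
    rw [Matrix.smul_apply, Matrix.one_apply]
    split_ifs <;> simp
  · have hdet := isUnit_det_map hD0
    have hmul := congrArg (fun A => A.map (algebraMap K[X] (RatFunc K))) hdiv
    simp only [Matrix.map_mul, Matrix.map_add _ (map_add (algebraMap K[X] (RatFunc K))),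
      map_C_map] at hmul
    have hmulD : transferMatrix P M Y * D.map (algebraMap K[X] (RatFunc K))
        = P.map (algebraMap K (RatFunc K)) * S.map (algebraMap K[X] (RatFunc K)) := by
      rw [transferMatrix, Matrix.mul_assoc, hmul, Matrix.mul_add, show _ * _ * _ = _ from h,
        add_zero, Matrix.mul_assoc,
        Matrix.nonsing_inv_mul_cancel_left _ _ (isUnit_det_charmatrix_map M)]
    rw [Matrix.map_mul, map_C_map, ← hmulD, Matrix.mul_nonsing_inv_cancel_right _ _ hdet]

/-! ### The Krylov space `W` and the case of equal rank -/

/-- The `K`-linear map `K[y]^m → K^n` sending `r` to the sum of the `r_j(M) Y_j`, where the `Y_j` are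
the columns of `Y`. -/
noncomputable def krylovMap {n m : ℕ} (M : Matrix (Fin n) (Fin n) K)
    (Y : Matrix (Fin n) (Fin m) K) : (Fin m → K[X]) →ₗ[K] (Fin n → K) :=
  moduleEval M ∘ₗ ((Y.map Polynomial.C).mulVecLin.restrictScalars K)

section
variable {l n m : ℕ} (M : Matrix (Fin n) (Fin n) K) (Y : Matrix (Fin n) (Fin m) K)

theorem krylovMap_apply (r : Fin m → K[X]) :
    krylovMap M Y r = moduleEval M (Y.map Polynomial.C *ᵥ r) := rfl

theorem krylovMap_smul (p : K[X]) (r : Fin m → K[X]) :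
    krylovMap M Y (p • r) = Polynomial.aeval M p *ᵥ krylovMap M Y r := by
  rw [krylovMap_apply, Matrix.mulVec_smul, moduleEval_smul, krylovMap_apply]

theorem krylovMap_C (u : Fin m → K) :
    krylovMap M Y (fun j => Polynomial.C (u j)) = Y *ᵥ u := by
  have h : Y.map Polynomial.C *ᵥ (fun j => Polynomial.C (u j))
      = fun i => Polynomial.C ((Y *ᵥ u) i) := by
    ext1 i
    simp [Matrix.mulVec, dotProduct]
  rw [krylovMap_apply, h, moduleEval_C]

theorem krylovMap_eq_sum (r : Fin m → K[X]) :
    krylovMap M Y r = ∑ j, Polynomial.aeval M (r j) *ᵥ Y.col j := by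
  have h : r = ∑ j, r j • fun i => Polynomial.C ((Pi.single j 1 : Fin m → K) i) := by
    ext1 i
    simp [Finset.sum_apply, Pi.single_apply, apply_ite]
  conv_lhs => rw [h]
  rw [map_sum]
  refine Finset.sum_congr rfl fun j _ => ?_
  rw [krylovMap_smul, krylovMap_C, Matrix.mulVec_single_one]

theorem aeval_mulVec_mem_range_krylovMap (p : K[X]) {w : Fin n → K}
    (hw : w ∈ LinearMap.range (krylovMap M Y)) :
    Polynomial.aeval M p *ᵥ w ∈ LinearMap.range (krylovMap M Y) := by
  obtain ⟨r, rfl⟩ := hw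
  exact ⟨p • r, krylovMap_smul M Y p r⟩

theorem mulVec_mem_range_krylovMap {w : Fin n → K}
    (hw : w ∈ LinearMap.range (krylovMap M Y)) :
    M *ᵥ w ∈ LinearMap.range (krylovMap M Y) := by
  simpa using aeval_mulVec_mem_range_krylovMap M Y Polynomial.X hw

theorem pow_mul_mulVec_mem_range_krylovMap (k : ℕ) (u : Fin m → K) :
    (M ^ k * Y) *ᵥ u ∈ LinearMap.range (krylovMap M Y) := by
  have := aeval_mulVec_mem_range_krylovMap M Y (Polynomial.X ^ k) ⟨_, krylovMap_C M Y u⟩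
  simpa using this

theorem range_krylov_le (d : ℕ) :
    LinearMap.range (krylov M Y d).mulVecLin ≤ LinearMap.range (krylovMap M Y) := by
  rw [Matrix.range_mulVecLin, Submodule.span_le]
  rintro _ ⟨⟨i, j⟩, rfl⟩
  have := pow_mul_mulVec_mem_range_krylovMap M Y i (Pi.single j 1)
  rwa [Matrix.mulVec_single_one] at this

theorem rank_mul_krylov_le {ι : Type*} [Fintype ι] (L : Matrix ι (Fin n) K) (d : ℕ) :
    (L * krylov M Y d).rank ≤ Module.finrank K (LinearMap.range (krylovMap M Y)) :=
  (Matrix.rank_mul_le_right _ _).trans (Submodule.finrank_mono (range_krylov_le M Y d))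

variable {M Y}

theorem range_krylov_eq {ι : Type*} [Fintype ι] {L : Matrix ι (Fin n) K} {d : ℕ}
    (h : (L * krylov M Y d).rank = Module.finrank K (LinearMap.range (krylovMap M Y))) :
    LinearMap.range (krylov M Y d).mulVecLin = LinearMap.range (krylovMap M Y) :=
  Submodule.eq_of_le_of_finrank_le (range_krylov_le M Y d)
    (h ▸ Matrix.rank_mul_le_right L (krylov M Y d))

/-- `L` maps `W` onto the column space of the product, which has the same dimension as `W`. -/
theorem ker_domRestrict_eq_bot {ι : Type*} [Fintype ι] {L : Matrix ι (Fin n) K} {d : ℕ}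
    (h : (L * krylov M Y d).rank = Module.finrank K (LinearMap.range (krylovMap M Y))) :
    LinearMap.ker (L.mulVecLin.domRestrict (LinearMap.range (krylovMap M Y))) = ⊥ := by
  have hrange : LinearMap.range (L.mulVecLin.domRestrict (LinearMap.range (krylovMap M Y)))
      = LinearMap.range (L * krylov M Y d).mulVecLin := by
    rw [LinearMap.range_domRestrict, ← range_krylov_eq h, ← LinearMap.range_comp,
      Matrix.mulVecLin_mul]
  have := (L.mulVecLin.domRestrict (LinearMap.range (krylovMap M Y))).finrank_range_add_finrank_ker
  rw [hrange] at this
  rw [Matrix.rank] at h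
  exact Submodule.finrank_eq_zero.mp (by omega)

theorem exists_eq_mul_of_mulVec_mem {ι κ : Type*} [Fintype ι] [Fintype κ] [DecidableEq κ]
    {B : Matrix (Fin n) κ K}
    {R : Matrix (Fin n) ι K} (h : ∀ u, B *ᵥ u ∈ LinearMap.range R.mulVecLin) :
    ∃ Z : Matrix ι κ K, B = R * Z := by
  choose z hz using fun j => h (Pi.single j 1)
  refine ⟨Matrix.of fun i j => z j i, Matrix.ext fun i j => ?_⟩
  have := congrFun (hz j) i
  rw [Matrix.mulVec_single_one] at this
  exact this.symm

/-- A matrix that is injective on the column space of `R` has all row vectors on that space as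
combinations of its rows. -/
theorem exists_mul_sub_eq_zero {ι κ : Type*} [Fintype ι] [DecidableEq ι] [Fintype κ]
    {L : Matrix ι (Fin n) K} {R : Matrix (Fin n) κ K} [DecidableEq κ]
    (h : LinearMap.ker (L.mulVecLin.domRestrict (LinearMap.range R.mulVecLin)) = ⊥)
    (B : Matrix (Fin l) (Fin n) K) : ∃ G : Matrix (Fin l) ι K, (B - G * L) * R = 0 := by
  -- `G` is `B` composed with a left inverse `g` of `L` on the column space of `R`.
  obtain ⟨g, hg⟩ := LinearMap.exists_leftInverse_of_injective _ h
  let G := LinearMap.toMatrix' (B.mulVecLin ∘ₗ (LinearMap.range R.mulVecLin).subtype ∘ₗ g)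
  refine ⟨G, Matrix.ext_of_mulVec_single fun j => ?_⟩
  have hw := LinearMap.congr_fun hg ⟨R *ᵥ Pi.single j 1, LinearMap.mem_range_self R.mulVecLin _⟩
  simp only [LinearMap.comp_apply, LinearMap.domRestrict_apply, Matrix.mulVecLin_apply,
    LinearMap.id_apply] at hw
  rw [← Matrix.mulVec_mulVec, Matrix.sub_mulVec, ← Matrix.mulVec_mulVec,
    LinearMap.toMatrix'_mulVec, LinearMap.comp_apply, LinearMap.comp_apply, hw]
  ext i
  simp

theorem isDescribable_transferMatrix {P : Matrix (Fin l) (Fin n) K} {d : ℕ} (hd : 0 < d)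
    (h : ((krylov Mᵀ Pᵀ d)ᵀ * krylov M Y d).rank
      = Module.finrank K (LinearMap.range (krylovMap M Y))) :
    IsDescribable (transferMatrix P M Y) d := by
  have hR := range_krylov_eq h
  constructor
  · obtain ⟨G, hG⟩ : ∃ G : Matrix (Fin d × Fin m) (Fin m) K, M ^ d * Y = krylov M Y d * G :=
      exists_eq_mul_of_mulVec_mem fun u => hR ▸ pow_mul_mulVec_mem_range_krylovMap M Y d u
    refine exists_right_description P M Y G hd ?_
    simp [hG, transferMatrix]
  · have hker := ker_domRestrict_eq_bot h
    rw [← hR] at hker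
    -- On `W`, `P M^d` is a combination of the rows of `L`. As `W` is stable and contains the
    -- columns of `Y`, the difference has zero transfer matrix; transposing reduces to the
    -- right-hand case.
    obtain ⟨G, hG⟩ := exists_mul_sub_eq_zero hker (P * M ^ d)
    obtain ⟨A, hA⟩ : ∃ A : Matrix (Fin d × Fin m) (Fin d × Fin m) K,
        M * krylov M Y d = krylov M Y d * A := by
      refine exists_eq_mul_of_mulVec_mem fun u => hR ▸ ?_
      rw [← Matrix.mulVec_mulVec]
      exact mulVec_mem_range_krylovMap M Y (hR ▸ LinearMap.mem_range_self _ u)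
    obtain ⟨Z, hZ⟩ : ∃ Z : Matrix (Fin d × Fin m) (Fin m) K,
        Y = krylov M Y d * Z := by
      refine exists_eq_mul_of_mulVec_mem fun u => hR ▸ ?_
      simpa using pow_mul_mulVec_mem_range_krylovMap M Y 0 u
    have hzero := transferMatrix_eq_zero hG hA hZ
    obtain ⟨N, D, hD, hdeg, hND⟩ := exists_right_description Yᵀ Mᵀ Pᵀ Gᵀ hd (by
      rw [← Matrix.transpose_eq_zero, transferMatrix_transpose]
      simpa [Matrix.transpose_sub, Matrix.transpose_mul, Matrix.transpose_pow] using hzero)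
    refine ⟨Nᵀ, Dᵀ, by rwa [Matrix.det_transpose], fun i j => hdeg j i, ?_⟩
    rw [← Matrix.transpose_transpose (transferMatrix P M Y), transferMatrix_transpose, hND,
      Matrix.transpose_mul, Matrix.transpose_nonsing_inv]
    rfl

end

/-! ### Bounding the dimension of `W` by minors -/

/-- The submodule of the `s` whose image under `krylovMap M Z` lies in the `K[y]`-module generated
by the columns of `Y`. -/
noncomputable def relationsModulo {n m k : ℕ} (M : Matrix (Fin n) (Fin n) K)
    (Y : Matrix (Fin n) (Fin m) K) (Z : Matrix (Fin n) (Fin k) K) :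
    Submodule K[X] (Fin k → K[X]) where
  carrier := {s | krylovMap M Z s ∈ LinearMap.range (krylovMap M Y)}
  zero_mem' := by
    rw [Set.mem_ofPred_eq, map_zero]
    exact zero_mem _
  add_mem' hs ht := by
    simp only [Set.mem_ofPred_eq, map_add] at *
    exact add_mem hs ht
  smul_mem' p s hs := by
    simp only [Set.mem_ofPred_eq, krylovMap_smul] at *
    exact aeval_mulVec_mem_range_krylovMap M Y p hs

theorem mem_relationsModulo {n m k : ℕ} {M : Matrix (Fin n) (Fin n) K}
    {Y : Matrix (Fin n) (Fin m) K} {Z : Matrix (Fin n) (Fin k) K} {s : Fin k → K[X]} :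
    s ∈ relationsModulo M Y Z ↔ krylovMap M Z s ∈ LinearMap.range (krylovMap M Y) := Iff.rfl

theorem projMatrix_mulVec_of_le {n m : ℕ} (r : Fin m → K[X]) {i : Fin n} (hi : m ≤ i) :
    ((projMatrix K n m).map Polynomial.C *ᵥ r) i = 0 := by
  rw [Matrix.mulVec, dotProduct]
  refine Finset.sum_eq_zero fun j _ => ?_
  have : (i : ℕ) ≠ j := by omega
  simp [projMatrix, this]

theorem finrank_add_natDegree_minorsGcd_le {n m : ℕ} (M : Matrix (Fin n) (Fin n) K)
    (hm : m ≤ n) :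
    Module.finrank K (LinearMap.range (krylovMap M (projMatrix K n m)))
      + (minorsGcd M.charmatrix (n - m)).natDegree ≤ n := by
  let Y := projMatrix K n m
  let e : Fin (n - m) ↪ Fin n := ⟨fun i => ⟨m + i, by omega⟩, fun i j h => by
    simpa [Fin.ext_iff] using h⟩
  have he : ∀ j, (e j : ℕ) = m + j := fun _ => rfl
  let Z : Matrix (Fin n) (Fin (n - m)) K := (1 : Matrix (Fin n) (Fin n) K).submatrix id e
  let W := LinearMap.range (krylovMap M Y)
  let ψ := W.mkQ ∘ₗ krylovMap M Z
  have hker : ∀ s, s ∈ relationsModulo M Y Z ↔ ψ s = 0 := fun s =>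
    (Submodule.Quotient.mk_eq_zero W).symm
  -- The first `m` unit vectors are columns of `Y`, so the remaining ones, the columns of `Z`, span
  -- `K^n` modulo `W`.
  have hrange : LinearMap.range ψ = ⊤ := by
    refine LinearMap.range_eq_top.mpr fun w => ?_
    obtain ⟨u, rfl⟩ := W.mkQ_surjective w
    refine ⟨fun j => Polynomial.C (u (e j)), ?_⟩
    refine (Submodule.Quotient.eq W).mpr ?_
    rw [krylovMap_C, ← neg_mem_iff]
    refine ⟨fun j => Polynomial.C (u (j.castLE hm)), ?_⟩
    rw [krylovMap_C, neg_sub, eq_sub_iff_add_eq]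
    ext i
    by_cases hi : (i : ℕ) < m
    · have h1 : (Y *ᵥ fun j => u (j.castLE hm)) i = u i := by
        rw [Matrix.mulVec, dotProduct, Finset.sum_eq_single ⟨i, hi⟩]
        · simp [Y, projMatrix]
        · intro j _ hj
          have : (i : ℕ) ≠ j := fun h => hj (Fin.ext h.symm)
          simp [Y, projMatrix, this]
        · simp
      have h2 : (Z *ᵥ fun j => u (e j)) i = 0 := by
        rw [Matrix.mulVec, dotProduct]
        refine Finset.sum_eq_zero fun j _ => ?_
        have : i ≠ e j := fun h => by
          have := congrArg Fin.val h
          rw [he] at this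
          omega
        simp [Z, this]
      rw [Pi.add_apply, h1, h2, add_zero]
    · have h1 : (Y *ᵥ fun j => u (j.castLE hm)) i = 0 := by
        rw [Matrix.mulVec, dotProduct]
        refine Finset.sum_eq_zero fun j _ => ?_
        have : (i : ℕ) ≠ j := by omega
        simp [Y, projMatrix, this]
      have h2 : (Z *ᵥ fun j => u (e j)) i = u i := by
        obtain ⟨j, rfl⟩ : ∃ j, i = e j := ⟨⟨i - m, by omega⟩, by
          refine Fin.ext ?_
          rw [he]
          exact (Nat.add_sub_cancel' (by omega)).symm⟩
        simp [Z, Matrix.mulVec, dotProduct, Matrix.one_apply]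
      rw [Pi.add_apply, h1, h2, zero_add]
  have hfull := finrank_eq_of_smul_mem (N := relationsModulo M Y Z) M.charpoly_monic.ne_zero
    (fun s => by
      rw [mem_relationsModulo, krylovMap_smul, Matrix.aeval_self_charpoly, Matrix.zero_mulVec]
      exact zero_mem _)
  obtain ⟨D, hD, hmem, hdeg, -⟩ := exists_basis_matrix hfull
  rw [finrank_quotient_eq_finrank_range ψ hker, hrange, finrank_top] at hdeg
  have hW := W.finrank_quotient_add_finrank
  rw [Module.finrank_fin_fun, ← hdeg] at hW
  -- For a relation `s`, `Z s - Y r` evaluates to zero for some `r`, hence equals `(yI - M) q`. On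
  -- the last `n - m` rows `Y` vanishes and `Z` is the identity, which leaves `s`.
  have hcol : ∀ j, ∃ q, (fun i => D i j) = M.charmatrix.submatrix e id *ᵥ q := by
    intro j
    obtain ⟨r, hr⟩ := hmem j
    obtain ⟨q, hq⟩ := exists_eq_charmatrix_mulVec_add M
      (Z.map Polynomial.C *ᵥ (fun i => D i j) - Y.map Polynomial.C *ᵥ r)
    refine ⟨q, ?_⟩
    have h0 : moduleEval M (Z.map Polynomial.C *ᵥ (fun i => D i j) - Y.map Polynomial.C *ᵥ r)
        = 0 := by
      rw [map_sub, ← krylovMap_apply, ← krylovMap_apply, hr, sub_self]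
    rw [h0] at hq
    ext1 i
    have := congrFun hq (e i)
    simp only [Pi.sub_apply, Pi.add_apply, Pi.zero_apply, map_zero, add_zero, Y] at this
    rw [projMatrix_mulVec_of_le r (Nat.le_add_right m i), sub_zero] at this
    refine Eq.trans ?_ this
    simp [Z, Matrix.mulVec, dotProduct, Matrix.one_apply]
  choose q hq using hcol
  have hDq : D = M.charmatrix.submatrix e id * Matrix.of fun i j => q j i :=
    Matrix.ext fun i j => congrFun (hq j) i
  have hdvd : minorsGcd M.charmatrix (n - m) ∣ D.det := by
    rw [hDq]
    exact minorsGcd_dvd_iff.mpr (det_submatrix_mul_mem_minorsIdeal _ _ _)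
  have := Polynomial.natDegree_le_of_dvd hdvd hD
  change Module.finrank K W + _ ≤ n
  omega

/-! ### Translation from remainders modulo `f` -/

/-- The coefficients of `x^0, …, x^(n-1)` in the remainder modulo `f`. -/
noncomputable def remCoeffs (n : ℕ) (f : K[X]) : K[X] →ₗ[K] (Fin n → K) where
  toFun g i := (g % f).coeff i
  map_add' g h := by
    ext i
    simp [Polynomial.add_mod]
  map_smul' c g := by
    ext i
    rw [Polynomial.mod_def, Polynomial.smul_modByMonic, ← Polynomial.mod_def]
    simp

section
variable {n : ℕ} {f : K[X]} (a : K[X])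

theorem remCoeffs_apply (g : K[X]) (i : Fin n) : remCoeffs n f g i = (g % f).coeff i := rfl

theorem remCoeffs_mul (hf : f.natDegree = n) (hn : 0 < n) (g : K[X]) :
    remCoeffs n f (a * g) = mulMatrix n f a *ᵥ remCoeffs n f g := by
  have hmod : remCoeffs n f (a * g) = remCoeffs n f (a * (g % f)) := by
    ext i
    rw [remCoeffs_apply, remCoeffs_apply]
    congr 1
    conv_lhs => rw [← EuclideanDomain.mod_add_div g f, mul_add, mul_left_comm]
    simp [Polynomial.add_mod]
  have hsum : a * (g % f) = ∑ j : Fin n, (g % f).coeff j • (a * Polynomial.X ^ (j : ℕ)) := by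
    have hlt : (g % f).natDegree < n := by
      rw [← hf]
      exact Polynomial.natDegree_mod_lt _ (by omega)
    conv_lhs => rw [(g % f).as_sum_range' n hlt, Finset.mul_sum, Finset.sum_range]
    refine Finset.sum_congr rfl fun j _ => ?_
    rw [← Polynomial.C_mul_X_pow_eq_monomial, Polynomial.smul_eq_C_mul, mul_left_comm]
  rw [hmod, hsum, map_sum]
  ext i
  simp [Finset.sum_apply, Matrix.mulVec, dotProduct, mulMatrix, remCoeffs_apply, mul_comm]

theorem remCoeffs_pow_mul (hf : f.natDegree = n) (hn : 0 < n) (k : ℕ) (g : K[X]) :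
    remCoeffs n f (a ^ k * g) = mulMatrix n f a ^ k *ᵥ remCoeffs n f g := by
  induction k with
  | zero => simp
  | succ k ih =>
    rw [pow_succ', mul_assoc, remCoeffs_mul a hf hn, ih, Matrix.mulVec_mulVec, ← pow_succ']

theorem remCoeffs_comp_mul (hf : f.natDegree = n) (hn : 0 < n) (p g : K[X]) :
    remCoeffs n f (p.comp a * g) = Polynomial.aeval (mulMatrix n f a) p *ᵥ remCoeffs n f g := by
  induction p using Polynomial.induction_on' with
  | add p q hp hq => rw [Polynomial.add_comp, add_mul, map_add, hp, hq, map_add, Matrix.add_mulVec]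
  | monomial k c =>
    rw [Polynomial.monomial_comp, mul_assoc, ← Polynomial.smul_eq_C_mul, map_smul,
      remCoeffs_pow_mul a hf hn, Polynomial.aeval_monomial, ← Algebra.smul_def, Matrix.smul_mulVec]

/-- For `j < m ≤ n`, `x^j` is its own remainder, with coordinates the `j`-th column of `X`. -/
theorem remCoeffs_evalAt {m : ℕ} (hf : f.natDegree = n) (hn : 0 < n) (hm : m ≤ n)
    (r : Fin m → K[X]) :
    remCoeffs n f (evalAt a r) = krylovMap (mulMatrix n f a) (projMatrix K n m) r := by
  rw [evalAt, map_sum, krylovMap_eq_sum]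
  refine Finset.sum_congr rfl fun j _ => ?_
  rw [remCoeffs_comp_mul a hf hn]
  congr 1
  ext i
  have hf0 : f ≠ 0 := by
    rintro rfl
    simp at hf
    omega
  have hmod : (Polynomial.X ^ (j : ℕ) : K[X]) % f = Polynomial.X ^ (j : ℕ) := by
    rw [Polynomial.mod_eq_self_iff hf0, Polynomial.degree_X_pow,
      Polynomial.degree_eq_natDegree hf0, hf]
    exact_mod_cast lt_of_lt_of_le j.2 hm
  rw [remCoeffs_apply, hmod, Polynomial.coeff_X_pow]
  rfl

theorem mem_relModule_iff {l m : ℕ} (hf : f.natDegree = n) (hn : 0 < n) (hl : l ≤ n) (hm : m ≤ n)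
    (r : Fin m → K[X]) : r ∈ relModule l m f a ↔ ∀ (k : ℕ) (i : Fin l),
      (mulMatrix n f a ^ k *ᵥ krylovMap (mulMatrix n f a) (projMatrix K n m) r) (i.castLE hl)
        = 0 := by
  simp only [← remCoeffs_evalAt a hf hn hm, ← remCoeffs_pow_mul a hf hn]
  exact ⟨fun h k i => h k i i.2, fun h k i hi => h k ⟨i, hi⟩⟩

theorem projMatrix_transpose_mulVec {m : ℕ} (hm : m ≤ n) (w : Fin n → K) (i : Fin m) :
    ((projMatrix K n m)ᵀ *ᵥ w) i = w (i.castLE hm) := by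
  rw [Matrix.mulVec, dotProduct, Finset.sum_eq_single (i.castLE hm)]
  · simp [projMatrix]
  · intro j _ hj
    have : (j : ℕ) ≠ i := fun h => hj (Fin.ext h)
    simp [projMatrix, this]
  · simp

theorem blockHankel_eq (n m d : ℕ) (f a : K[X]) : blockHankel n m d f a =
    (krylov (mulMatrix n f a)ᵀ ((projMatrix K n m)ᵀ)ᵀ d)ᵀ
      * krylov (mulMatrix n f a) (projMatrix K n m) d := by
  rw [blockHankel]
  congr 1
  ext p j
  rw [leftMatrix, krylov, Matrix.of_apply, Matrix.transpose_apply, Matrix.of_apply,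
    ← Matrix.transpose_pow, ← Matrix.transpose_mul, Matrix.transpose_apply]

theorem nu_add_natDegree_minorsGcd {m : ℕ} (hm : m ≤ n) :
    nu n m f a + (minorsGcd (mulMatrix n f a).charmatrix (n - m)).natDegree = n := by
  have h := sum_natDegree_invariantFactor (A := (mulMatrix n f a).charmatrix)
    (mulMatrix n f a).charpoly_monic.ne_zero hm
  rw [nu, h]
  exact (Matrix.charpoly_natDegree_eq_dim _).trans (Fintype.card_fin n)

/-- The conditions with `k < d` say that `L` kills an element of `W`, which must then be zero. So
`R_{m,m}` is the kernel of the Krylov map, and the quotient by it is `W`. -/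
theorem nuTrunc_eq_finrank {m d : ℕ} (hf : f.natDegree = n) (hn : 0 < n) (hm : m ≤ n)
    (h : (blockHankel n m d f a).rank
      = Module.finrank K (LinearMap.range (krylovMap (mulMatrix n f a) (projMatrix K n m)))) :
    nuTrunc m f a
      = Module.finrank K (LinearMap.range (krylovMap (mulMatrix n f a) (projMatrix K n m))) := by
  have hmem : ∀ r, r ∈ relModule m m f a ↔
      krylovMap (mulMatrix n f a) (projMatrix K n m) r = 0 := by
    intro r
    rw [mem_relModule_iff a hf hn hm hm]
    refine ⟨fun hr => ?_, fun hr k i => by simp [hr]⟩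
    rw [blockHankel_eq] at h
    have hker := LinearMap.ker_eq_bot'.mp (ker_domRestrict_eq_bot h)
      ⟨_, LinearMap.mem_range_self _ r⟩ (by
      ext ⟨k, i⟩
      rw [LinearMap.domRestrict_apply, Matrix.mulVecLin_apply, Pi.zero_apply, ← hr k i,
        ← projMatrix_transpose_mulVec hm (_ *ᵥ _) i, Matrix.mulVec_mulVec]
      refine congrArg (· ⬝ᵥ _) (funext fun j => ?_)
      rw [krylov, Matrix.transpose_apply, Matrix.of_apply, ← Matrix.transpose_pow,
        ← Matrix.transpose_mul, Matrix.transpose_apply])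
    exact congrArg Subtype.val hker
  rw [nuTrunc, detDegree_eq_finrank, finrank_quotient_eq_finrank_range _ hmem]
  refine finrank_eq_of_smul_mem (mulMatrix n f a).charpoly_monic.ne_zero fun r => ?_
  rw [hmem, krylovMap_smul, Matrix.aeval_self_charpoly, Matrix.zero_mulVec]

end

end ModComp

theorem mainTheorem8 {K : Type*} [Field K] (n m d : ℕ) (f a : Polynomial K)
    (hf : f.natDegree = n) (ha : a.degree < n) (hm : 0 < m) (hmn : m ≤ n) (hd : 0 < d) :
    (ModComp.blockHankel n m d f a).rank ≤ ModComp.nu n m f a ∧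
    ((ModComp.blockHankel n m d f a).rank = ModComp.nu n m f a →
      ModComp.nuTrunc m f a = ModComp.nu n m f a ∧
      ModComp.IsDescribable (ModComp.fractionH n m f a) d) ∧
    ((ModComp.blockHankel n m d f a).rank = n →
      ModComp.nuTrunc m f a = ModComp.nu n m f a ∧ ModComp.nu n m f a = n ∧
      ModComp.IsDescribable (ModComp.fractionH n m f a) d) := by
  have hdim := ModComp.finrank_add_natDegree_minorsGcd_le (ModComp.mulMatrix n f a) hmn
  have hnu := ModComp.nu_add_natDegree_minorsGcd (f := f) a hmn
  have hrank := ModComp.rank_mul_krylov_le (ModComp.mulMatrix n f a) (ModComp.projMatrix K n m)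
    (ModComp.krylov (ModComp.mulMatrix n f a)ᵀ ((ModComp.projMatrix K n m)ᵀ)ᵀ d)ᵀ d
  rw [← ModComp.blockHankel_eq] at hrank
  have hmax : (ModComp.blockHankel n m d f a).rank = ModComp.nu n m f a →
      ModComp.nuTrunc m f a = ModComp.nu n m f a ∧
      ModComp.IsDescribable (ModComp.fractionH n m f a) d := by
    intro h
    -- The rank is at most `dim W`, which is at most `ν_m`; equality of the ends forces equality
    -- throughout.
    have heq : (ModComp.blockHankel n m d f a).rank = Module.finrank K (LinearMap.range
        (ModComp.krylovMap (ModComp.mulMatrix n f a) (ModComp.projMatrix K n m))) := by omega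
    refine ⟨?_, ?_⟩
    · rw [ModComp.nuTrunc_eq_finrank a hf (by omega) hmn heq, ← heq, h]
    · rw [ModComp.blockHankel_eq] at heq
      exact ModComp.isDescribable_transferMatrix hd heq
  refine ⟨by omega, hmax, fun h => ?_⟩
  -- `n = rank ≤ ν_m ≤ n`.
  have hn : ModComp.nu n m f a = n := by omega
  exact ⟨(hmax (h.trans hn.symm)).1, hn, (hmax (h.trans hn.symm)).2⟩
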